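/- **Model.** The $m\times n$ grid has nodes $v_{i,j}$ ($0\le i<m$, $0\le j<n$), with $v_{i,j},v_{i',j'}$ adjacent iff $|i-i'|+|j-j'|=1$. Identical, anonymous robots occupy nodes; each carries a light with a color from $Col$, visible to all robots. A robot with visible distance $\phi$ on $v_{i,j}$ sees its own color and, for each place at distance at most $\phi$, the multiset of colors of the robots there, or $\bot$ if there is no such node. Without a common chirality it obtains these data in all eight orientations (four rotations and their mirror images) and cannot tell them apart. An algorithm is a finite set of rules, not depending on $m,n$. A rule consists of a guard (an own color and, for each visible place, either an exact multiset of colors, or $\bot$, or "$\emptyset$ or $\bot$") and an action (a new color, and either staying or moving to a neighboring node, given relative to the guard; the guard must ensure that the target node exists). A robot is enabled if one of its eight views matches a guard. In the ASYNC model each robot repeats Look (take a snapshot), Compute (if the snapshot matches some rule, adopt the new color and the movement of a matching combination of view and rule, chosen by the scheduler; otherwise do nothing) and Move (execute the computed movement instantaneously). At each instant $t=0,1,2,\dots$ the scheduler activates an arbitrary set of robots, each of which executes its next phase; robots may thus act on outdated snapshots. The scheduler is fair: every robot is activated infinitely often. Initially all robots are about to Look. An algorithm solves terminating exploration of a grid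 from an initial configuration if, in every such execution from it, every node is visited by at least one robot and from some instant on no robot is enabled. **Theorem.** Let $\phi=2$ and $Col=\{\mathsf G,\mathsf W\}$. There is an algorithm that, in the ASYNC model without a common chirality, solves terminating exploration of every $m\times n$ grid with $m\ge 2$ and $n\ge 3$ with four robots, from the initial configuration $\{(v_{0,0},\{\mathsf G\}),(v_{0,1},\{\mathsf W\}),(v_{0,2},\{\mathsf W\}),(v_{1,0},\{\mathsf W\})\}$. -/

import Mathlib

namespace MyopicRobots

/-- `InGrid m n (i, j)`: the node `v_{i,j}` exists in the `m × n` grid. Row numbers `i` grow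
southwards and column numbers `j` grow eastwards. -/
def InGrid (m n : ℕ) (v : ℤ × ℤ) : Prop :=
  0 ≤ v.1 ∧ v.1 < m ∧ 0 ≤ v.2 ∧ v.2 < n

instance (m n : ℕ) (v : ℤ × ℤ) : Decidable (InGrid m n v) := by
  unfold InGrid; infer_instance

/-- The visible part of a robot: the node it occupies and the color of its light. -/
structure Robot (Col : Type) where
  pos : ℤ × ℤ
  color : Col

/-- Positions and colors of `k` robots. The names in `Fin k` are not visible to the robots. -/
abbrev Config (k : ℕ) (Col : Type) := Fin k → Robot Col

/-- The multiset of colors of the robots on node `v` (empty if `v` is not occupied). -/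
def colorsAt {k : ℕ} {Col : Type} (C : Config k Col) (v : ℤ × ℤ) : Multiset Col :=
  (Finset.univ.filter (fun r => (C r).pos = v)).val.map (fun r => (C r).color)

/-- What can be seen at `v`: `none` stands for `⊥` (the node does not exist), otherwise it is the
multiset of colors on `v`. -/
def cellAt (m n : ℕ) {k : ℕ} {Col : Type} (C : Config k Col) (v : ℤ × ℤ) :
    Option (Multiset Col) :=
  if InGrid m n v then some (colorsAt C v) else none

/-- Displacements of length at most `φ` in the grid distance. -/
abbrev Ball (φ : ℕ) := {d : ℤ × ℤ // |d.1| + |d.2| ≤ (φ : ℤ)}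

/-- The eight orientations in which a robot without chirality may read its surroundings:
the four rotations and their mirror images. -/
inductive Frame
  | north | east | south | west
  | northMirror | eastMirror | southMirror | westMirror

/-- The global displacement shown at place `(a, b)` of a view read in the given orientation, where
`(-1, 0)` is the place drawn above the center and `(0, -1)` the place drawn to its left. -/
def Frame.act : Frame → ℤ × ℤ → ℤ × ℤ
  | .north, (a, b) => (a, b)
  | .east, (a, b) => (b, -a)
  | .south, (a, b) => (-a, -b)
  | .west, (a, b) => (-b, a)
  | .northMirror, (a, b) => (a, -b)
  | .eastMirror, (a, b) => (-b, -a)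
  | .southMirror, (a, b) => (-a, b)
  | .westMirror, (a, b) => (b, a)

theorem Frame.abs_act (g : Frame) (d : ℤ × ℤ) :
    |(g.act d).1| + |(g.act d).2| = |d.1| + |d.2| := by
  obtain ⟨a, b⟩ := d
  cases g <;> simp [Frame.act, add_comm]

def Frame.actBall (g : Frame) {φ : ℕ} (d : Ball φ) : Ball φ :=
  ⟨g.act d.1, by rw [Frame.abs_act]; exact d.2⟩

/-- A view up to distance `φ`: the own color and the contents of all places of the ball. -/
structure View (φ : ℕ) (Col : Type) where
  own : Col
  cell : Ball φ → Option (Multiset Col)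

/-- The north view of robot `r` in configuration `C`. -/
def northView (m n φ : ℕ) {k : ℕ} {Col : Type} (C : Config k Col) (r : Fin k) : View φ Col where
  own := (C r).color
  cell d := cellAt m n C ((C r).pos + d.1)

/-- The same surroundings read in another orientation. If `V` is the north view of a robot, then
`V.inFrame g`, for the eight orientations `g`, are the eight views that the robot obtains. -/
def View.inFrame {φ : ℕ} {Col : Type} (V : View φ Col) (g : Frame) : View φ Col where
  own := V.own
  cell d := V.cell (g.actBall d)

/-- What a guard may prescribe for a place: an existing node with exactly the given multiset of
colors (possibly empty), no node, or "either an empty node or no node". -/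
inductive CellPattern (Col : Type)
  | exactly (M : Multiset Col)
  | noNode
  | emptyOrNoNode

def CellPattern.Accepts {Col : Type} : CellPattern Col → Option (Multiset Col) → Prop
  | .exactly M, x => x = some M
  | .noNode, x => x = none
  | .emptyOrNoNode, x => x = some 0 ∨ x = none

inductive Movement
  | idle | left | right | up | down

def Movement.vec : Movement → ℤ × ℤ
  | .idle => (0, 0)
  | .left => (0, -1)
  | .right => (0, 1)
  | .up => (-1, 0)
  | .down => (1, 0)

/-- A rule: a guard (own color and a pattern for every visible place) and an action (new color and
movement). A robot may only be sent to a place where the guard ensures that there is a node. -/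
structure Rule (φ : ℕ) (Col : Type) where
  own : Col
  guard : Ball φ → CellPattern Col
  newColor : Col
  movement : Movement
  legal : movement ≠ .idle → ∃ d : Ball φ, d.1 = movement.vec ∧ ¬ (guard d).Accepts none

/-- An algorithm is a finite collection of rules; their order plays no role. It knows neither the
size of the grid nor the number of robots. -/
abbrev Algorithm (φ : ℕ) (Col : Type) := List (Rule φ Col)

def Rule.Matches {φ : ℕ} {Col : Type} (R : Rule φ Col) (V : View φ Col) : Prop :=
  V.own = R.own ∧ ∀ d, (R.guard d).Accepts (V.cell d)

/-- Some of the eight views obtained from `V` matches the guard of some rule. -/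
def Algorithm.Enabled {φ : ℕ} {Col : Type} (A : Algorithm φ Col) (V : View φ Col) : Prop :=
  ∃ R ∈ A, ∃ g : Frame, R.Matches (V.inFrame g)

/-- The phase that a robot executes when it is activated next. `compute V`: it has taken the
snapshot `V`. `move d`: it has computed, and is going to move by the global displacement `d`
(with `d = 0` if it has decided not to move). -/
inductive Phase (φ : ℕ) (Col : Type)
  | look
  | compute (V : View φ Col)
  | move (d : ℤ × ℤ)

structure State (k φ : ℕ) (Col : Type) where
  config : Config k Col
  phase : Fin k → Phase φ Col

/-- Robot `r` executes its next phase in state `S`, and then has position and color `q` and next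
phase `p`. If several combinations of a view and a rule match, any of them may be selected. -/
def ExecutesPhase {k φ : ℕ} {Col : Type} (A : Algorithm φ Col) (m n : ℕ) (S : State k φ Col)
    (r : Fin k) (q : Robot Col) (p : Phase φ Col) : Prop :=
  match S.phase r with
  | .look => q = S.config r ∧ p = .compute (northView m n φ S.config r)
  | .compute V =>
      (∃ R ∈ A, ∃ g : Frame, R.Matches (V.inFrame g) ∧
        q = ⟨(S.config r).pos, R.newColor⟩ ∧ p = .move (g.act R.movement.vec)) ∨
      (¬ A.Enabled V ∧ q = S.config r ∧ p = .move 0)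
  | .move d => q = ⟨(S.config r).pos + d, (S.config r).color⟩ ∧ p = .look

/-- `S'` follows `S` when exactly the robots in `act` are activated, each for one phase. -/
def Step {k φ : ℕ} {Col : Type} (A : Algorithm φ Col) (m n : ℕ) (act : Set (Fin k))
    (S S' : State k φ Col) : Prop :=
  ∀ r, (r ∈ act → ExecutesPhase A m n S r (S'.config r) (S'.phase r)) ∧
    (r ∉ act → S'.config r = S.config r ∧ S'.phase r = S.phase r)

/-- `S 0, S 1, …` is the evolution of the system from the initial configuration `C₀` under the fair
asynchronous scheduler that activates the robots in `act t` at instant `t`. -/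
structure IsAsyncExecution {k φ : ℕ} {Col : Type} (A : Algorithm φ Col) (m n : ℕ)
    (C₀ : Config k Col) (act : ℕ → Set (Fin k)) (S : ℕ → State k φ Col) : Prop where
  init_config : (S 0).config = C₀
  init_phase : ∀ r, (S 0).phase r = .look
  step : ∀ t, Step A m n (act t) (S t) (S (t + 1))
  fair : ∀ r t, ∃ t', t ≤ t' ∧ r ∈ act t'

/-- Every node of the grid is visited by some robot, and from some instant on no robot is
enabled. -/
def TerminatingExploration {k φ : ℕ} {Col : Type} (A : Algorithm φ Col) (m n : ℕ)
    (E : ℕ → Config k Col) : Prop :=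
  (∀ v, InGrid m n v → ∃ t r, (E t r).pos = v) ∧
    ∃ T, ∀ t, T ≤ t → ∀ r, ¬ A.Enabled (northView m n φ (E t) r)

/-- In the ASYNC model without a common chirality, `A` solves terminating exploration of the
`m × n` grid from `C₀`. -/
def SolvesAsyncFrom {k φ : ℕ} {Col : Type} (A : Algorithm φ Col) (m n : ℕ)
    (C₀ : Config k Col) : Prop :=
  ∀ (act : ℕ → Set (Fin k)) (S : ℕ → State k φ Col), IsAsyncExecution A m n C₀ act S →
    TerminatingExploration A m n (fun t => (S t).config)

/-- The two colors. -/
inductive Color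
  | G | W

/-- Four robots in the northwest corner: `G`, `W`, `W` on `v_{0,0}`, `v_{0,1}`, `v_{0,2}` and `W`
on `v_{1,0}`. -/
def cornerConfig : Config 4 Color :=
  ![⟨(0, 0), .G⟩, ⟨(0, 1), .W⟩, ⟨(0, 2), .W⟩, ⟨(1, 0), .W⟩]

end MyopicRobots

/-! The algorithm leaves the scheduler no choice. In every configuration of the run but the last,
exactly one robot is enabled, all its possible actions have the same result, and this is either a
pure recoloring or a pure move. Then asynchrony is harmless: another robot can only take snapshots
in which it is disabled, and executing these, however late, does nothing. As color and position
never change in the same step, no configuration strictly between the two ends of a step is ever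
exposed. Fairness makes each step happen, so `solvesAsyncFrom_of_reach` reduces the theorem to a
single sequential run.

The run is a snake. The formation GWW/W-- advances along two adjacent rows; at the border it
regroups one row lower as its own mirror image. Without chirality the same rules then drive it back,
and by anonymity the exchange of roles is a mere permutation (`Reach.comp_perm`). The turn begins by
lowering the front robot and continues only if there is a further row below. In the last two rows
the run therefore stops right there, with the last corner just visited.

Each step involves few nodes. `soleStep_of_checkStep` verifies it by a finite computation that
treats the existence of nodes as true, false or unknown, and so covers all grid sizes and positions
at once. -/

namespace MyopicRobots

/-! ### Asynchronous executions with one enabled robot at a time -/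

section Sequential

variable {k φ : ℕ} {Col : Type} {A : Algorithm φ Col} {m n : ℕ}

/-- In `C` only robot `r` is enabled, each of its possible actions either keeps its position or
keeps its color, and each of them leads to `C'`. -/
structure SoleStep (A : Algorithm φ Col) (m n : ℕ) (C C' : Config k Col) (r : Fin k) : Prop where
  others : ∀ r', r' ≠ r → ¬ A.Enabled (northView m n φ C r')
  rest : ∀ r', r' ≠ r → C' r' = C r'
  enabled : A.Enabled (northView m n φ C r)
  outcome : ∀ R ∈ A, ∀ g : Frame, R.Matches ((northView m n φ C r).inFrame g) →
    (g.act R.movement.vec = 0 ∧ C' r = ⟨(C r).pos, R.newColor⟩) ∨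
    (R.newColor = (C r).color ∧ C' r = ⟨(C r).pos + g.act R.movement.vec, (C r).color⟩)

/-- `C'` is reached from `C` by a sequence of steps to each of which there is no alternative. -/
def Reach (A : Algorithm φ Col) (m n : ℕ) : Config k Col → Config k Col → Prop :=
  Relation.ReflTransGen fun C C' => ∃ r, SoleStep A m n C C' r

theorem Reach.trans {C C' C'' : Config k Col} (h : Reach A m n C C') (h' : Reach A m n C' C'') :
    Reach A m n C C'' :=
  Relation.ReflTransGen.trans h h'

/-- A phase whose execution leads to no action before the next snapshot. -/
def Phase.Quiet (A : Algorithm φ Col) : Phase φ Col → Prop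
  | .look => True
  | .compute V => ¬ A.Enabled V
  | .move d => d = 0

/-- The configuration is `C`, all robots but `r` are in a quiet phase, and `r` is in a phase
satisfying `Q`. -/
def Waiting (A : Algorithm φ Col) (C : Config k Col) (r : Fin k) (Q : Phase φ Col → Prop)
    (S : State k φ Col) : Prop :=
  S.config = C ∧ (∀ r', r' ≠ r → (S.phase r').Quiet A) ∧ Q (S.phase r)

/-- The configuration is `C` and all robots are in a quiet phase. -/
def Settled (A : Algorithm φ Col) (C : Config k Col) (S : State k φ Col) : Prop :=
  S.config = C ∧ ∀ r, (S.phase r).Quiet A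

/-- A stored disabled view stays harmless even if it is outdated. The current view matters only for
a Look executed now, whose snapshot must again be disabled. -/
theorem Step.quiet {act : Set (Fin k)} {S S' : State k φ Col} (h : Step A m n act S S')
    {r : Fin k} (hr : ¬ A.Enabled (northView m n φ S.config r)) (hq : (S.phase r).Quiet A) :
    S'.config r = S.config r ∧ (S'.phase r).Quiet A := by
  by_cases ha : r ∈ act
  · have := (h r).1 ha
    unfold ExecutesPhase at this
    cases hp : S.phase r with
    | look =>
      simp only [hp] at this
      exact ⟨this.1, by rw [this.2]; exact hr⟩
    | compute V =>
      simp only [hp] at this hq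
      rcases this with ⟨R, hR, g, hg, -⟩ | ⟨-, h1, h2⟩
      · exact absurd ⟨R, hR, g, hg⟩ hq
      · exact ⟨h1, by rw [h2]; rfl⟩
    | move d =>
      simp only [hp] at this hq
      obtain rfl : d = 0 := hq
      refine ⟨by rw [this.1, add_zero], by rw [this.2]; trivial⟩
  · obtain ⟨h1, h2⟩ := (h r).2 ha
    exact ⟨h1, by rwa [h2]⟩

variable {C₀ C C' : Config k Col} {act : ℕ → Set (Fin k)} {S : ℕ → State k φ Col} {r : Fin k}

/-- If the other robots have nothing to do, then the state persists until `r` is activated. -/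
theorem IsAsyncExecution.exists_of_waiting (E : IsAsyncExecution A m n C₀ act S)
    (hC : ∀ r', r' ≠ r → ¬ A.Enabled (northView m n φ C r')) {Q : Phase φ Col → Prop} {t : ℕ}
    (ht : Waiting A C r Q (S t)) :
    ∃ t', Waiting A C r Q (S t') ∧
      (∀ r', r' ≠ r → (S (t' + 1)).config r' = C r' ∧ ((S (t' + 1)).phase r').Quiet A) ∧
      ExecutesPhase A m n (S t') r ((S (t' + 1)).config r) ((S (t' + 1)).phase r) := by
  obtain ⟨t', htt, hr⟩ := E.fair r t
  have key : ∀ t₁, Waiting A C r Q (S t₁) →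
      ∀ r', r' ≠ r → (S (t₁ + 1)).config r' = C r' ∧ ((S (t₁ + 1)).phase r').Quiet A := by
    rintro t₁ ⟨rfl, h2, -⟩ r' hr'
    exact (E.step t₁).quiet (hC r' hr') (h2 r' hr')
  -- Fairness gives some activation of `r`, not necessarily the first after `t`; the induction on
  -- the delay stops at the first one.
  obtain ⟨d, rfl⟩ := Nat.exists_eq_add_of_le htt
  clear htt
  induction d generalizing t with
  | zero => exact ⟨t, ht, key t ht, ((E.step t) r).1 hr⟩
  | succ d ih =>
    by_cases ha : r ∈ act t
    · exact ⟨t, ht, key t ht, ((E.step t) r).1 ha⟩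
    · obtain ⟨h1, h2⟩ := ((E.step t) r).2 ha
      refine ih (t := t + 1) ⟨?_, fun r' hr' => (key t ht r' hr').2, by rw [h2]; exact ht.2.2⟩
        (by rwa [show t + 1 + d = t + (d + 1) by ring])
      funext r'
      by_cases h : r' = r
      · rw [h, h1, ht.1]
      · exact (key t ht r' h).1

theorem Waiting.of_rest {Q : Phase φ Col → Prop} {S : State k φ Col}
    (h : ∀ r', r' ≠ r → S.config r' = C r' ∧ (S.phase r').Quiet A) (h1 : S.config r = C r)
    (h2 : Q (S.phase r)) : Waiting A C r Q S := by
  refine ⟨funext fun r' => ?_, fun r' hr' => (h r' hr').2, h2⟩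
  by_cases hr : r' = r
  · rw [hr, h1]
  · exact (h r' hr).1

theorem Waiting.settled {S : State k φ Col} (h : Waiting A C r (Phase.Quiet A) S) :
    Settled A C S := by
  refine ⟨h.1, fun r' => ?_⟩
  by_cases hr : r' = r
  · rw [hr]; exact h.2.2
  · exact h.2.1 r' hr

/-- Robot `r` may first have to finish an idle cycle begun with an old snapshot. Then it looks at
`C`, computes and moves, while the others remain quiet. The phases are treated backwards, each
relying on the one that follows it. -/
theorem IsAsyncExecution.exists_settled_of_soleStep (E : IsAsyncExecution A m n C₀ act S)
    (h : SoleStep A m n C C' r) {t : ℕ} (ht : Settled A C (S t)) :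
    ∃ t', Settled A C' (S t') := by
  have move : ∀ t d, Waiting A C r (· = .move d) (S t) →
      C' r = ⟨(C r).pos + d, (C r).color⟩ → ∃ t', Settled A C' (S t') := by
    intro t d hw hd
    obtain ⟨t', h1, h2, h3⟩ := E.exists_of_waiting h.others hw
    simp only [ExecutesPhase, h1.2.2, h1.1] at h3
    refine ⟨t' + 1, (Waiting.of_rest (r := r) (fun r' hr' => ?_) (h3.1.trans hd.symm) ?_).settled⟩
    · rw [h.rest r' hr']; exact h2 r' hr'
    · rw [h3.2]; trivial
  have compute : ∀ t, Waiting A C r (· = .compute (northView m n φ C r)) (S t) →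
      ∃ t', Settled A C' (S t') := by
    intro t hw
    obtain ⟨t', h1, h2, h3⟩ := E.exists_of_waiting h.others hw
    simp only [ExecutesPhase, h1.2.2, h1.1] at h3
    rcases h3 with ⟨R, hR, g, hg, hq, hp⟩ | ⟨h4, -⟩
    · rcases h.outcome R hR g hg with ⟨h4, h5⟩ | ⟨h4, h5⟩
      -- A recoloring is complete after Compute; the pending zero move is quiet.
      · refine ⟨t' + 1, (Waiting.of_rest (r := r) (fun r' hr' => ?_)
          (hq.trans h5.symm) ?_).settled⟩
        · rw [h.rest r' hr']; exact h2 r' hr'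
        · rw [hp]; exact h4
      -- The color is kept, so the configuration is still `C` while the move is pending.
      · exact move (t' + 1) _ (Waiting.of_rest h2 (by rw [hq, h4]) hp) h5
    · exact absurd h.enabled h4
  have look : ∀ t, Waiting A C r (· = .look) (S t) → ∃ t', Settled A C' (S t') := by
    intro t hw
    obtain ⟨t', h1, h2, h3⟩ := E.exists_of_waiting h.others hw
    simp only [ExecutesPhase, h1.2.2, h1.1] at h3
    exact compute (t' + 1) (Waiting.of_rest h2 h3.1 h3.2)
  have stay : ∀ t, Waiting A C r (· = .move 0) (S t) → ∃ t', Settled A C' (S t') := by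
    intro t hw
    obtain ⟨t', h1, h2, h3⟩ := E.exists_of_waiting h.others hw
    simp only [ExecutesPhase, h1.2.2, h1.1, add_zero] at h3
    exact look (t' + 1) (Waiting.of_rest h2 h3.1 h3.2)
  have hw : Waiting A C r (· = (S t).phase r) (S t) := ⟨ht.1, fun r' _ => ht.2 r', rfl⟩
  have hq := ht.2 r
  cases hp : (S t).phase r with
  | look => rw [hp] at hw; exact look t hw
  | move d =>
    rw [hp] at hw hq
    obtain rfl : d = 0 := hq
    exact stay t hw
  | compute V =>
    rw [hp] at hw hq
    obtain ⟨t', h1, h2, h3⟩ := E.exists_of_waiting h.others hw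
    simp only [ExecutesPhase, h1.2.2, h1.1] at h3
    rcases h3 with ⟨R, hR, g, hg, -⟩ | ⟨-, h4, h5⟩
    · exact absurd ⟨R, hR, g, hg⟩ hq
    · exact stay (t' + 1) (Waiting.of_rest h2 h4 h5)

theorem IsAsyncExecution.exists_settled_of_reach (E : IsAsyncExecution A m n C₀ act S)
    (h : Reach A m n C₀ C) : ∃ t, Settled A C (S t) := by
  induction h with
  | refl => exact ⟨0, E.init_config, fun r => by rw [E.init_phase r]; trivial⟩
  | tail _ h ih =>
    obtain ⟨t, ht⟩ := ih
    obtain ⟨r, hr⟩ := h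
    exact E.exists_settled_of_soleStep hr ht

theorem IsAsyncExecution.config_eq_of_settled (E : IsAsyncExecution A m n C₀ act S)
    (hC : ∀ r, ¬ A.Enabled (northView m n φ C r)) {T : ℕ} (hT : Settled A C (S T)) (t : ℕ)
    (ht : T ≤ t) : (S t).config = C := by
  suffices Settled A C (S t) from this.1
  induction t, ht using Nat.le_induction with
  | base => exact hT
  | succ t _ ih =>
    obtain ⟨rfl, h⟩ := ih
    exact ⟨funext fun r => ((E.step t).quiet (hC r) (h r)).1,
      fun r => ((E.step t).quiet (hC r) (h r)).2⟩

/-- An algorithm that leaves no choice to the scheduler solves terminating exploration if its only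
run visits all nodes and ends in a configuration without enabled robots. -/
theorem solvesAsyncFrom_of_reach
    (hv : ∀ v, InGrid m n v → ∃ C, Reach A m n C₀ C ∧ ∃ r, (C r).pos = v)
    (hT : ∃ C, Reach A m n C₀ C ∧ ∀ r, ¬ A.Enabled (northView m n φ C r)) :
    SolvesAsyncFrom A m n C₀ := by
  intro act S E
  refine ⟨fun v hvm => ?_, ?_⟩
  · obtain ⟨C, hC, r, hr⟩ := hv v hvm
    obtain ⟨t, ht⟩ := E.exists_settled_of_reach hC
    exact ⟨t, r, by simpa [ht.1] using hr⟩
  · obtain ⟨C, hC, hd⟩ := hT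
    obtain ⟨T, hT⟩ := E.exists_settled_of_reach hC
    refine ⟨T, fun t ht r => ?_⟩
    simp only [E.config_eq_of_settled hd hT t ht]
    exact hd r

/-! ### Robots are anonymous -/

theorem cellAt_comp_perm (C : Config k Col) (σ : Equiv.Perm (Fin k)) (v : ℤ × ℤ) :
    cellAt m n (C ∘ σ) v = cellAt m n C v := by
  unfold cellAt colorsAt
  congr 2
  have : (Finset.univ.filter fun r => (C r).pos = v) =
      (Finset.univ.filter fun r => ((C ∘ σ) r).pos = v).map σ.toEmbedding := by
    ext r
    simp only [Finset.mem_filter, Finset.mem_univ, true_and, Finset.mem_map_equiv,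
      Function.comp_apply, Equiv.apply_symm_apply]
  rw [this, Finset.map_val, Multiset.map_map]
  rfl

theorem northView_comp_perm (C : Config k Col) (σ : Equiv.Perm (Fin k)) (r : Fin k) :
    northView m n φ (C ∘ σ) r = northView m n φ C (σ r) := by
  simp only [northView, cellAt_comp_perm, Function.comp_apply]

theorem SoleStep.comp_perm (h : SoleStep A m n C C' r) (σ : Equiv.Perm (Fin k)) :
    SoleStep A m n (C ∘ σ) (C' ∘ σ) (σ.symm r) where
  others r' hr' := by
    rw [northView_comp_perm]
    exact h.others _ fun e => hr' (by rw [← e, Equiv.symm_apply_apply])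
  rest r' hr' := h.rest _ fun e => hr' (by rw [← e, Equiv.symm_apply_apply])
  enabled := by
    rw [northView_comp_perm, Equiv.apply_symm_apply]
    exact h.enabled
  outcome := by
    simp only [northView_comp_perm, Function.comp_apply, Equiv.apply_symm_apply]
    exact h.outcome

/-- A turn restores the formation only up to a permutation of the robots; this lets the run continue
as if the roles were unchanged. -/
theorem Reach.comp_perm (h : Reach A m n C C') (σ : Equiv.Perm (Fin k)) :
    Reach A m n (C ∘ σ) (C' ∘ σ) := by
  induction h with
  | refl => exact .refl
  | tail _ h ih =>
    obtain ⟨r, hr⟩ := h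
    exact ih.tail ⟨_, hr.comp_perm σ⟩

end Sequential

/-! ### The algorithm -/

instance : DecidableEq Color
  | .G, .G => isTrue rfl
  | .W, .W => isTrue rfl
  | .G, .W => isFalse nofun
  | .W, .G => isFalse nofun

/-- What a guard of our algorithm prescribes for a place: exactly one robot, of color `c`; an
existing node without robots; no node; no robots. -/
inductive Symbol
  | occupied (c : Color)
  | vacant
  | wall
  | free

def Symbol.pattern : Symbol → CellPattern Color
  | .occupied c => .exactly {c}
  | .vacant => .exactly 0
  | .wall => .noNode
  | .free => .emptyOrNoNode

/-- A rule whose guard is given by a list of places; all other places have to be free. -/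
structure RuleSpec where
  own : Color
  places : List ((ℤ × ℤ) × Symbol)
  newColor : Color
  movement : Movement
  legal : movement = .idle ∨ (places.lookup movement.vec).getD .free = .vacant

def RuleSpec.symbol (R : RuleSpec) (d : ℤ × ℤ) : Symbol := (R.places.lookup d).getD .free

def RuleSpec.toRule (R : RuleSpec) : Rule 2 Color where
  own := R.own
  guard d := (R.symbol d.1).pattern
  newColor := R.newColor
  movement := R.movement
  legal h := by
    refine ⟨⟨R.movement.vec, by cases R.movement <;> simp [Movement.vec]⟩, rfl, ?_⟩
    rw [RuleSpec.symbol, R.legal.resolve_left h]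
    simp [Symbol.pattern, CellPattern.Accepts]

open MyopicRobots.Symbol Movement Color in
/-- The rules, for robots that travel eastwards and turn to the south. The first four of them make
the formation `GWW/W--` advance by one column, the others turn it around at the eastern border. -/
def ruleSpecs : List RuleSpec := [
  { own := W, newColor := W, movement := right, legal := Or.inr rfl
    -- The robot's own node has to be listed, since by default a place must be free of robots.
    places := [((0, 0), occupied W), ((-1, 0), occupied G), ((-1, 1), occupied W),
      ((0, 1), vacant)] },
  { own := W, newColor := W, movement := right, legal := Or.inr rfl
    places := [((0, 0), occupied W), ((0, -1), occupied W), ((0, -2), occupied G),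
      ((1, -1), occupied W), ((0, 1), vacant)] },
  { own := W, newColor := W, movement := right, legal := Or.inr rfl
    places := [((0, 0), occupied W), ((0, -1), occupied G), ((1, 0), occupied W),
      ((0, 2), occupied W), ((0, 1), vacant)] },
  { own := G, newColor := G, movement := right, legal := Or.inr rfl
    places := [((0, 0), occupied G), ((0, 2), occupied W), ((1, 1), occupied W),
      ((0, 1), vacant)] },
  { own := W, newColor := W, movement := down, legal := Or.inr rfl
    places := [((0, 0), occupied W), ((0, -1), occupied W), ((0, -2), occupied G),
      ((1, -1), occupied W), ((0, 1), wall), ((1, 0), vacant)] },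
  -- The requirement that `(2, 0)` exists causes termination: it fails on the last two rows.
  { own := W, newColor := G, movement := idle, legal := Or.inl rfl
    places := [((0, 0), occupied W), ((0, -1), occupied G), ((1, 0), occupied W),
      ((1, 1), occupied W), ((2, 0), vacant)] },
  { own := G, newColor := G, movement := down, legal := Or.inr rfl
    places := [((0, 0), occupied G), ((0, 1), occupied G), ((1, 1), occupied W),
      ((1, 0), vacant)] },
  { own := G, newColor := G, movement := right, legal := Or.inr rfl
    places := [((0, 0), occupied G), ((1, -1), occupied G), ((1, 0), occupied W),
      ((1, 1), occupied W), ((0, 1), vacant)] },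
  { own := G, newColor := W, movement := idle, legal := Or.inl rfl
    places := [((0, 0), occupied G), ((0, 1), occupied W), ((0, 2), occupied W)] },
  { own := W, newColor := W, movement := down, legal := Or.inr rfl
    places := [((0, 0), occupied W), ((-1, 0), occupied G), ((0, -1), occupied W),
      ((0, -2), occupied W), ((1, 0), vacant)] },
  { own := G, newColor := G, movement := down, legal := Or.inr rfl
    places := [((0, 0), occupied G), ((1, -1), occupied W), ((2, 0), occupied W),
      ((1, 0), vacant)] }]

def snakeAlgorithm : Algorithm 2 Color := ruleSpecs.map RuleSpec.toRule

/-! ### Checking steps with partial knowledge of the grid -/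

/-- Whether a place with symbol `s` may accept a node with at most one robot, of color `o`, if
`known` says what is known about its existence. -/
def Symbol.mayAccept : Symbol → Option Color → Option Bool → Bool
  | .occupied c, some c', _ => c = c'
  | .vacant, none, known => known ≠ some false
  | .wall, none, known => known ≠ some true
  | .free, none, _ => true
  | _, _, _ => false

/-- Whether a place with symbol `s` has to accept such a node. -/
def Symbol.mustAccept : Symbol → Option Color → Option Bool → Bool
  | .occupied c, some c', _ => c = c'
  | .vacant, none, known => known = some true
  | .wall, none, known => known = some false
  | .free, none, _ => true
  | _, _, _ => false

/-- The color of a robot on `v`, if there is one. -/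
def robotAt {k : ℕ} (C : Config k Color) (v : ℤ × ℤ) : Option Color :=
  (List.finRange k).findSome? fun r => if (C r).pos = v then some (C r).color else none

theorem colorsAt_of_robotAt {k : ℕ} {C : Config k Color}
    (hC : Function.Injective fun r => (C r).pos) (v : ℤ × ℤ) :
    colorsAt C v = match robotAt C v with
      | some c => {c}
      | none => 0 := by
  cases h : robotAt C v with
  | none =>
    simp only [robotAt, List.findSome?_eq_none_iff, List.mem_finRange, forall_const,
      ite_eq_right_iff, reduceCtorEq, imp_false] at h
    simp [colorsAt, h]
  | some c =>
    obtain ⟨r, -, hr⟩ := List.exists_of_findSome?_eq_some h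
    simp only [Option.ite_none_right_eq_some, Option.some.injEq] at hr
    obtain ⟨rfl, rfl⟩ := hr
    have : (Finset.univ.filter fun r' => (C r').pos = (C r).pos) = {r} := by
      ext r'
      simpa using ⟨fun h => hC h, fun h => by rw [h]⟩
    simp [colorsAt, this]

/-- A cell with robots as described by `o`, that exists according to `known`. -/
def CellFits (o : Option Color) (known : Option Bool) (x : Option (Multiset Color)) : Prop :=
  match o with
  | some c => x = some {c}
  | none => (x = some 0 ∧ known ≠ some false) ∨ (x = none ∧ known ≠ some true)

/-- Unknown existence counts in favor of `mayAccept` and against `mustAccept`. The former thus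
bounds the possible actions from above, the latter certifies that one exists. -/
theorem Symbol.mayAccept_of_accepts {s : Symbol} {o : Option Color} {known : Option Bool}
    {x : Option (Multiset Color)} (hx : CellFits o known x) (h : s.pattern.Accepts x) :
    s.mayAccept o known = true := by
  cases s <;> cases o <;>
    simp only [Symbol.pattern, CellPattern.Accepts, CellFits, Symbol.mayAccept] at * <;>
    aesop

theorem Symbol.accepts_of_mustAccept {s : Symbol} {o : Option Color} {known : Option Bool}
    {x : Option (Multiset Color)} (hx : CellFits o known x) (h : s.mustAccept o known = true) :
    s.pattern.Accepts x := by
  cases s <;> cases o <;>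
    simp only [Symbol.pattern, CellPattern.Accepts, CellFits, Symbol.mustAccept] at * <;>
    aesop

/-- The position of `v` when columns are read eastwards (`s = 1`) or westwards (`s = -1`). -/
def mirror (s : ℤ) (v : ℤ × ℤ) : ℤ × ℤ := (v.1, s * v.2)

/-- The places of `Ball 2`. -/
def ballPlaces : List (ℤ × ℤ) :=
  [(0, 0), (0, 1), (0, -1), (1, 0), (-1, 0), (0, 2), (0, -2), (2, 0), (-2, 0),
    (1, 1), (1, -1), (-1, 1), (-1, -1)]

theorem mem_ballPlaces {d : ℤ × ℤ} : d ∈ ballPlaces ↔ |d.1| + |d.2| ≤ 2 := by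
  constructor
  · intro h
    simp only [ballPlaces, List.mem_cons, List.not_mem_nil, or_false] at h
    rcases h with h | h | h | h | h | h | h | h | h | h | h | h | h <;> subst h <;> decide
  · obtain ⟨a, b⟩ := d
    intro h
    simp only at h
    have ha := abs_nonneg a
    have hb := abs_nonneg b
    have h1 := abs_le.1 (show |a| ≤ 2 by linarith)
    have h2 := abs_le.1 (show |b| ≤ 2 by linarith)
    obtain ⟨h3, h4⟩ := h1
    obtain ⟨h5, h6⟩ := h2
    interval_cases a <;> interval_cases b <;> first | decide | (exfalso; revert h; decide)

/-- The eight orientations. -/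
def frames : List Frame :=
  [.north, .east, .south, .west, .northMirror, .eastMirror, .southMirror, .westMirror]

theorem mem_frames (g : Frame) : g ∈ frames := by
  cases g <;> simp [frames]

section Check

variable {k : ℕ} (C C' : Config k Color) (known : ℤ × ℤ → Option Bool) (s : ℤ) (r : Fin k)

/-- Whether rule `R` may match the view of robot `r` read in orientation `g`. -/
def mayMatch (R : RuleSpec) (g : Frame) : Bool :=
  (C r).color = R.own && ballPlaces.all fun d =>
    (R.symbol d).mayAccept (robotAt C ((C r).pos + mirror s (g.act d)))
      (known ((C r).pos + mirror s (g.act d)))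

/-- Whether rule `R` has to match the view of robot `r` read in orientation `g`. -/
def mustMatch (R : RuleSpec) (g : Frame) : Bool :=
  (C r).color = R.own && ballPlaces.all fun d =>
    (R.symbol d).mustAccept (robotAt C ((C r).pos + mirror s (g.act d)))
      (known ((C r).pos + mirror s (g.act d)))

/-- Robot `r` is certainly not enabled. -/
def checkDisabled : Bool :=
  ruleSpecs.all fun R => frames.all fun g => !mayMatch C known s r R g

/-- Robot `r` can certainly perform an action, and any such action leads to `C'`. -/
def checkActs : Bool :=
  (ruleSpecs.any fun R => frames.any fun g => mustMatch C known s r R g) &&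
  ruleSpecs.all fun R => frames.all fun g => !mayMatch C known s r R g ||
    ((decide (g.act R.movement.vec = 0) && decide ((C' r).pos = (C r).pos) &&
        decide ((C' r).color = R.newColor)) ||
      (decide (R.newColor = (C r).color) &&
        decide ((C' r).pos = (C r).pos + mirror s (g.act R.movement.vec)) &&
        decide ((C' r).color = (C r).color)))

/-- The step from `C` to `C'` is performed by robot `r`, without an alternative. -/
def checkStep : Bool :=
  checkActs C C' known s r && (List.finRange k).all fun r' => decide (r' = r) ||
    (decide ((C' r').pos = (C r').pos) && decide ((C' r').color = (C r').color) &&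
      checkDisabled C known s r')

/-- All robots are on different nodes. -/
def checkDistinct : Bool :=
  (List.finRange k).all fun r => (List.finRange k).all fun r' =>
    decide (r = r') || !decide ((C r).pos = (C r').pos)

/-! ### Transfer of the check from a local picture to the grid -/

variable {C C' known s r}

theorem injective_pos_of_checkDistinct (h : checkDistinct C = true) :
    Function.Injective fun r => (C r).pos := by
  intro r r' hr
  simp only [checkDistinct, List.all_eq_true, List.mem_finRange, forall_const] at h
  simpa [show (C r).pos = (C r').pos from hr] using h r r'

/-- `C` placed in a grid, with its origin on node `o`. -/
def place (o : ℤ × ℤ) (s : ℤ) (C : Config k Color) : Config k Color :=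
  fun r => ⟨o + mirror s (C r).pos, (C r).color⟩

/-- The `m × n` grid, seen from `o` in direction `s`, is as described by `known`. -/
def Fits (m n : ℕ) (o : ℤ × ℤ) (s : ℤ) (known : ℤ × ℤ → Option Bool) : Prop :=
  ∀ v b, known v = some b → (InGrid m n (o + mirror s v) ↔ b = true)

variable {m n : ℕ} {o : ℤ × ℤ}

theorem mirror_mirror (hs : s * s = 1) (v : ℤ × ℤ) : mirror s (mirror s v) = v := by
  simp [mirror, ← mul_assoc, hs]

theorem mirror_add (v w : ℤ × ℤ) : mirror s (v + w) = mirror s v + mirror s w := by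
  simp [mirror, mul_add]

theorem place_pos_injective (hs : s * s = 1) (hC : Function.Injective fun r => (C r).pos) :
    Function.Injective fun r => (place o s C r).pos := by
  intro r r' h
  have h : mirror s (C r).pos = mirror s (C r').pos := add_left_cancel h
  exact hC (by simpa [mirror_mirror hs] using congrArg (mirror s) h)

theorem robotAt_place (hs : s * s = 1) (v : ℤ × ℤ) :
    robotAt (place o s C) (o + mirror s v) = robotAt C v := by
  unfold robotAt
  congr 1
  funext r
  have : (place o s C r).pos = o + mirror s v ↔ (C r).pos = v :=
    ⟨fun h => by simpa [mirror_mirror hs] using congrArg (mirror s) (add_left_cancel h),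
      fun h => by rw [← h]; rfl⟩
  exact if_congr this rfl rfl

/-- Distinct positions make the color found by `robotAt` the whole content of a node; `hin` ensures
that occupied nodes lie in the grid. -/
theorem cellFits_place (hs : s * s = 1) (hC : checkDistinct C = true)
    (hk : Fits m n o s known) (hin : ∀ r, known (C r).pos = some true) (v : ℤ × ℤ) :
    CellFits (robotAt C v) (known v) (cellAt m n (place o s C) (o + mirror s v)) := by
  have hc := colorsAt_of_robotAt
    (place_pos_injective (o := o) hs (injective_pos_of_checkDistinct hC)) (o + mirror s v)
  rw [robotAt_place hs] at hc
  have hg := hk v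
  cases h : robotAt C v with
  | none =>
    rw [h] at hc
    by_cases hgrid : InGrid m n (o + mirror s v)
    · refine Or.inl ⟨by simp [cellAt, hgrid, hc], fun hf => ?_⟩
      simpa using (hg _ hf).1 hgrid
    · refine Or.inr ⟨by simp [cellAt, hgrid], fun hf => ?_⟩
      exact hgrid ((hg _ hf).2 rfl)
  | some c =>
    rw [h] at hc
    obtain ⟨r, -, hr⟩ := List.exists_of_findSome?_eq_some h
    simp only [Option.ite_none_right_eq_some] at hr
    have hgrid : InGrid m n (o + mirror s v) := (hg true (by rw [← hr.1]; exact hin r)).2 rfl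
    simp [CellFits, cellAt, hgrid, hc]

theorem place_pos_add (hs : s * s = 1) (r : Fin k) (d : ℤ × ℤ) :
    (place o s C r).pos + d = o + mirror s ((C r).pos + mirror s d) := by
  rw [mirror_add, mirror_mirror hs, ← add_assoc]
  rfl

theorem mayMatch_of_matches (hs : s * s = 1) (hC : checkDistinct C = true)
    (hk : Fits m n o s known) (hin : ∀ r, known (C r).pos = some true) {R : RuleSpec} {g : Frame}
    (h : R.toRule.Matches ((northView m n 2 (place o s C) r).inFrame g)) :
    mayMatch C known s r R g = true := by
  simp only [mayMatch, Bool.and_eq_true, decide_eq_true_eq, List.all_eq_true]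
  refine ⟨h.1, fun d hd => Symbol.mayAccept_of_accepts ?_ (h.2 ⟨d, mem_ballPlaces.1 hd⟩)⟩
  simp only [View.inFrame, northView, Frame.actBall, place_pos_add hs]
  exact cellFits_place hs hC hk hin _

theorem matches_of_mustMatch (hs : s * s = 1) (hC : checkDistinct C = true)
    (hk : Fits m n o s known) (hin : ∀ r, known (C r).pos = some true) {R : RuleSpec} {g : Frame}
    (h : mustMatch C known s r R g = true) :
    R.toRule.Matches ((northView m n 2 (place o s C) r).inFrame g) := by
  simp only [mustMatch, Bool.and_eq_true, decide_eq_true_eq, List.all_eq_true] at h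
  refine ⟨h.1, fun d => Symbol.accepts_of_mustAccept ?_ (h.2 d.1 (mem_ballPlaces.2 d.2))⟩
  simp only [View.inFrame, northView, Frame.actBall, place_pos_add hs]
  exact cellFits_place hs hC hk hin _

theorem not_enabled_of_checkDisabled (hs : s * s = 1) (hC : checkDistinct C = true)
    (hk : Fits m n o s known) (hin : ∀ r, known (C r).pos = some true)
    (h : checkDisabled C known s r = true) :
    ¬ snakeAlgorithm.Enabled (northView m n 2 (place o s C) r) := by
  rintro ⟨R, hR, g, hg⟩
  obtain ⟨R, hR', rfl⟩ := List.mem_map.1 hR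
  simp only [checkDisabled, List.all_eq_true] at h
  simpa [mayMatch_of_matches hs hC hk hin hg] using h R hR' g (mem_frames g)

theorem soleStep_of_checkStep (hs : s * s = 1) (hC : checkDistinct C = true)
    (hk : Fits m n o s known) (hin : ∀ r, known (C r).pos = some true)
    (h : checkStep C C' known s r = true) :
    SoleStep snakeAlgorithm m n (place o s C) (place o s C') r := by
  simp only [checkStep, checkActs, Bool.and_eq_true, List.all_eq_true, List.any_eq_true,
    List.mem_finRange, forall_const, Bool.or_eq_true, decide_eq_true_eq, Bool.not_eq_true'] at h
  obtain ⟨⟨⟨R, hR, g, -, hg⟩, h2⟩, h3⟩ := h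
  refine ⟨fun r' hr' => ?_, fun r' hr' => ?_, ?_, ?_⟩
  · exact not_enabled_of_checkDisabled hs hC hk hin ((h3 r').resolve_left hr').2
  · obtain ⟨⟨h4, h5⟩, -⟩ := (h3 r').resolve_left hr'
    simp [place, h4, h5]
  · exact ⟨_, List.mem_map.2 ⟨R, hR, rfl⟩, g, matches_of_mustMatch hs hC hk hin hg⟩
  · intro R hR g hg
    obtain ⟨R, hR', rfl⟩ := List.mem_map.1 hR
    have := (h2 R hR' g (mem_frames g)).resolve_left
      (by simp [mayMatch_of_matches hs hC hk hin hg])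
    rcases this with ⟨⟨h4, h5⟩, h6⟩ | ⟨⟨h4, h5⟩, h6⟩
    · exact Or.inl ⟨h4, by simp [place, h5, h6, RuleSpec.toRule]⟩
    · refine Or.inr ⟨h4, ?_⟩
      rw [place_pos_add hs, place, h5, h6]
      rfl

end Check

/-! ### The run of the algorithm -/

/-- What is known about the nodes near a formation on rows `0, 1` and columns `0, 1, 2`: these
exist; column `3` exists or not as told by `east`, and row `2` as told by `south`. -/
def area (east south : Option Bool) (v : ℤ × ℤ) : Option Bool :=
  match (if v.1 = 0 ∨ v.1 = 1 then some true else if v.1 = 2 then south else none),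
    (if v.2 = 0 ∨ v.2 = 1 ∨ v.2 = 2 then some true else if v.2 = 3 then east else none) with
  | some true, x => x
  | some false, _ => some false
  | none, some false => some false
  | none, _ => none

/-- The node in row `i` and in the `j`-th column in direction `s`. -/
def origin (n : ℕ) (s i j : ℤ) : ℤ × ℤ := (i, if s = 1 then j else n - 1 - j)

section Run

variable {m n : ℕ} {s i j : ℤ}

/-- The reflection of columns preserves the range `0, …, n - 1`, so the direction drops out, and
rows and columns can be treated independently. -/
theorem fits_area (hs : s = 1 ∨ s = -1) (hi : 0 ≤ i) (hm : i + 1 < m) (hj : 0 ≤ j)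
    (hn : j + 2 < n) {east south : Option Bool}
    (heast : ∀ b, east = some b → (j + 3 < n ↔ b = true))
    (hsouth : ∀ b, south = some b → (i + 2 < m ↔ b = true)) :
    Fits m n (origin n s i j) s (area east south) := by
  rintro ⟨x, y⟩ b h
  have hgrid : InGrid m n (origin n s i j + mirror s (x, y)) ↔
      (0 ≤ i + x ∧ i + x < m) ∧ 0 ≤ j + y ∧ j + y < n := by
    rcases hs with rfl | rfl <;> simp [InGrid, origin, mirror] <;> omega
  rw [hgrid]
  simp only [area] at h
  have hrow : ∀ b, (if x = 0 ∨ x = 1 then some true else if x = 2 then south else none) = some b →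
      ((0 ≤ i + x ∧ i + x < m) ↔ b = true) := by
    intro b hb
    split_ifs at hb with h1 h2
    · simp only [Option.some.injEq] at hb
      subst hb
      simp only [iff_true]
      omega
    · rw [← hsouth b hb, h2]
      omega
  have hcol : ∀ b, (if y = 0 ∨ y = 1 ∨ y = 2 then some true else if y = 3 then east else none) =
      some b → ((0 ≤ j + y ∧ j + y < n) ↔ b = true) := by
    intro b hb
    split_ifs at hb with h1 h2
    · simp only [Option.some.injEq] at hb
      subst hb
      simp only [iff_true]
      omega
    · rw [← heast b hb, h2]
      omega
  generalize (if x = 0 ∨ x = 1 then some true else if x = 2 then south else none) = p at h hrow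
  generalize (if y = 0 ∨ y = 1 ∨ y = 2 then some true else if y = 3 then east else none) = q
    at h hcol
  rcases p with _ | _ | _ <;> rcases q with _ | _ | _ <;> simp_all

open Color

/-- The first robot of the lower row has advanced. -/
def lowerAdvanced : Config 4 Color := ![⟨(0, 0), G⟩, ⟨(0, 1), W⟩, ⟨(0, 2), W⟩, ⟨(1, 1), W⟩]

/-- The two robots at the ends have advanced. -/
def endsAdvanced : Config 4 Color := ![⟨(0, 0), G⟩, ⟨(0, 1), W⟩, ⟨(0, 3), W⟩, ⟨(1, 1), W⟩]

/-- All robots but the last one of the upper row have advanced. -/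
def lastBehind : Config 4 Color := ![⟨(0, 0), G⟩, ⟨(0, 2), W⟩, ⟨(0, 3), W⟩, ⟨(1, 1), W⟩]

/-- The configurations passed through at the eastern border. -/
def turning : Fin 6 → Config 4 Color := ![
  ![⟨(0, 0), G⟩, ⟨(0, 1), W⟩, ⟨(1, 2), W⟩, ⟨(1, 1), W⟩],
  ![⟨(0, 0), G⟩, ⟨(0, 1), G⟩, ⟨(1, 2), W⟩, ⟨(1, 1), W⟩],
  ![⟨(1, 0), G⟩, ⟨(0, 1), G⟩, ⟨(1, 2), W⟩, ⟨(1, 1), W⟩],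
  ![⟨(1, 0), G⟩, ⟨(0, 2), G⟩, ⟨(1, 2), W⟩, ⟨(1, 1), W⟩],
  ![⟨(1, 0), W⟩, ⟨(0, 2), G⟩, ⟨(1, 2), W⟩, ⟨(1, 1), W⟩],
  ![⟨(1, 0), W⟩, ⟨(0, 2), G⟩, ⟨(2, 2), W⟩, ⟨(1, 1), W⟩]]

/-- The roles that the robots take over by turning around. -/
def turnPerm : Equiv.Perm (Fin 4) := ⟨![2, 0, 3, 1], ![1, 3, 0, 2], by decide, by decide⟩

/-- One step from `C` to `C'`, verified by the check. -/
theorem reach_place_of_checkStep (hs : s = 1 ∨ s = -1) (hi : 0 ≤ i) (hm : i + 1 < m)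
    (hj : 0 ≤ j) (hn : j + 2 < n) (east south : Option Bool)
    (heast : ∀ b, east = some b → (j + 3 < n ↔ b = true))
    (hsouth : ∀ b, south = some b → (i + 2 < m ↔ b = true)) {C C' : Config 4 Color} (r : Fin 4)
    (h : (checkDistinct C && (List.finRange 4).all (fun r => area east south (C r).pos = some true)
      && checkStep C C' (area east south) 1 r && checkStep C C' (area east south) (-1) r)
      = true) :
    Reach snakeAlgorithm m n (place (origin n s i j) s C) (place (origin n s i j) s C') := by
  simp only [Bool.and_eq_true, List.all_eq_true, List.mem_finRange, forall_const,
    decide_eq_true_eq] at h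
  obtain ⟨⟨⟨h1, h2⟩, h3⟩, h4⟩ := h
  refine Relation.ReflTransGen.single ⟨r, soleStep_of_checkStep (by rcases hs with rfl | rfl <;> rfl)
    h1 (fits_area hs hi hm hj hn heast hsouth) h2 ?_⟩
  rcases hs with rfl | rfl
  exacts [h3, h4]

/-- No knowledge of the borders is used, so the step serves both the advance and the turn. -/
theorem reach_lowerAdvanced (hs : s = 1 ∨ s = -1) (hi : 0 ≤ i) (hm : i + 1 < m) (hj : 0 ≤ j)
    (hn : j + 2 < n) :
    Reach snakeAlgorithm m n (place (origin n s i j) s cornerConfig)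
      (place (origin n s i j) s lowerAdvanced) :=
  reach_place_of_checkStep hs hi hm hj hn none none (by simp) (by simp) 3 (by decide +kernel)

theorem reach_advance (hs : s = 1 ∨ s = -1) (hi : 0 ≤ i) (hm : i + 1 < m) (hj : 0 ≤ j)
    (hn : j + 3 < n) :
    Reach snakeAlgorithm m n (place (origin n s i j) s cornerConfig)
      (place (origin n s i (j + 1)) s cornerConfig) := by
  have hn' : j + 2 < n := by omega
  have step {C C' : Config 4 Color} := reach_place_of_checkStep (C := C) (C' := C') hs hi hm hj hn'
    (some true) none (by simpa using hn) (by simp)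
  refine (reach_lowerAdvanced hs hi hm hj hn').trans ?_
  refine (step (C' := endsAdvanced) 2 (by decide +kernel)).trans ?_
  refine (step (C' := lastBehind) 1 (by decide +kernel)).trans ?_
  -- The check compares configurations in one local picture, where the target is the formation
  -- shifted by one column.
  suffices h : place (origin n s i (j + 1)) s cornerConfig =
      place (origin n s i j) s (place (0, 1) 1 cornerConfig) by
    rw [h]
    exact step 0 (by decide +kernel)
  funext r
  simp only [place, origin, mirror, Robot.mk.injEq, and_true, Prod.ext_iff, Prod.fst_add,
    Prod.snd_add]
  rcases hs with rfl | rfl <;> simp <;> ring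

/-- Row `i + 2` is left unknown, because this step is also the last one of the whole run. -/
theorem reach_turning_zero (hs : s = 1 ∨ s = -1) (hi : 0 ≤ i) (hm : i + 1 < m) (hn : 3 ≤ n) :
    Reach snakeAlgorithm m n (place (origin n s i (n - 3)) s cornerConfig)
      (place (origin n s i (n - 3)) s (turning 0)) := by
  refine (reach_lowerAdvanced hs hi hm (by omega) (by omega)).trans ?_
  exact reach_place_of_checkStep hs hi hm (by omega) (by omega) (some false) none (by simp) (by simp)
    2 (by decide +kernel)

theorem reach_turn (hs : s = 1 ∨ s = -1) (hi : 0 ≤ i) (hm : i + 2 < m) (hn : 3 ≤ n) :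
    Reach snakeAlgorithm m n (place (origin n s i (n - 3)) s cornerConfig)
      (place (origin n (-s) (i + 1) 0) (-s) cornerConfig ∘ turnPerm) := by
  have step {C C' : Config 4 Color} := reach_place_of_checkStep (C := C) (C' := C') hs hi
    (show i + 1 < m by omega) (show (0 : ℤ) ≤ n - 3 by omega) (show (n : ℤ) - 3 + 2 < n by omega) (some false) (some true)
    (by simp) (by simpa using hm)
  refine (reach_turning_zero hs hi (by omega) hn).trans ?_
  refine (step (C' := turning 1) 1 (by decide +kernel)).trans ?_
  refine (step (C' := turning 2) 0 (by decide +kernel)).trans ?_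
  refine (step (C' := turning 3) 1 (by decide +kernel)).trans ?_
  refine (step (C' := turning 4) 0 (by decide +kernel)).trans ?_
  refine (step (C' := turning 5) 2 (by decide +kernel)).trans ?_
  -- In the old local picture the new formation has its origin at `(1, 2)` and is read backwards.
  suffices h : place (origin n (-s) (i + 1) 0) (-s) cornerConfig ∘ turnPerm =
      place (origin n s i (n - 3)) s (place (1, 2) (-1) cornerConfig ∘ turnPerm) by
    rw [h]
    exact step 1 (by decide +kernel)
  funext r
  simp only [place, origin, mirror, Function.comp_apply, Robot.mk.injEq, and_true, Prod.ext_iff,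
    Prod.fst_add, Prod.snd_add]
  rcases hs with rfl | rfl
  · simp
    ring_nf
    trivial
  · simp
    ring_nf

theorem not_enabled_turning_zero (hs : s = 1 ∨ s = -1) (hi : 0 ≤ i) (hm : i + 2 = m) (hn : 3 ≤ n)
    (r : Fin 4) :
    ¬ snakeAlgorithm.Enabled
      (northView m n 2 (place (origin n s i (n - 3)) s (turning 0)) r) := by
  have h : ∀ s, s = 1 ∨ s = -1 → ∀ r,
      checkDisabled (turning 0) (area (some false) (some false)) s r = true := by
    rintro s (rfl | rfl) <;> decide +kernel
  exact not_enabled_of_checkDisabled (by rcases hs with rfl | rfl <;> rfl) (by decide +kernel)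
    (fits_area hs hi (by omega) (by omega) (by omega) (by simp) (by simp; omega))
    (by decide +kernel) (h s hs r)

/-! ### The route through the grid -/

theorem reach_along_row (hs : s = 1 ∨ s = -1) (hi : 0 ≤ i) (hm : i + 1 < m) (k : ℕ)
    (hk : k + 3 ≤ n) :
    Reach snakeAlgorithm m n (place (origin n s i 0) s cornerConfig)
      (place (origin n s i k) s cornerConfig) := by
  induction k with
  | zero => exact .refl
  | succ k ih =>
    push_cast
    exact (ih (by omega)).trans (reach_advance hs hi hm (by omega) (by omega))

/-- The formation reaches the beginning of each row but the last one. -/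
theorem reach_row (hn : 3 ≤ n) (i : ℕ) (hi : i + 1 < m) :
    ∃ s : ℤ, (s = 1 ∨ s = -1) ∧ ∃ σ : Equiv.Perm (Fin 4),
      Reach snakeAlgorithm m n cornerConfig (place (origin n s i 0) s cornerConfig ∘ σ) := by
  induction i with
  | zero =>
    refine ⟨1, Or.inl rfl, 1, ?_⟩
    have h : place (origin n 1 (0 : ℕ) 0) 1 cornerConfig ∘ (1 : Equiv.Perm (Fin 4)) =
        cornerConfig := by
      funext r
      simp [place, origin, mirror, ← Prod.zero_eq_mk]
    rw [h]
    exact .refl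
  | succ i ih =>
    obtain ⟨s, hs, σ, h⟩ := ih (by omega)
    refine ⟨-s, by omega, σ.trans turnPerm, h.trans ?_⟩
    have h1 := reach_along_row (m := m) (n := n) hs (Int.natCast_nonneg i) (by omega) (n - 3) (by omega)
    have h2 := reach_turn (m := m) (n := n) hs (Int.natCast_nonneg i) (by omega) hn
    rw [Nat.cast_sub hn] at h1
    push_cast at h1 ⊢
    exact (h1.trans h2).comp_perm σ

theorem snakeAlgorithm_solves (hm : 2 ≤ m) (hn : 3 ≤ n) :
    SolvesAsyncFrom snakeAlgorithm m n cornerConfig := by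
  have along : ∀ i : ℕ, i + 1 < m → ∃ s : ℤ, (s = 1 ∨ s = -1) ∧ ∃ σ : Equiv.Perm (Fin 4),
      (∀ k : ℕ, k + 3 ≤ n →
        Reach snakeAlgorithm m n cornerConfig (place (origin n s i k) s cornerConfig ∘ σ)) ∧
      Reach snakeAlgorithm m n cornerConfig (place (origin n s i (n - 3)) s lowerAdvanced ∘ σ) ∧
      Reach snakeAlgorithm m n cornerConfig (place (origin n s i (n - 3)) s (turning 0) ∘ σ) := by
    intro i hi
    obtain ⟨s, hs, σ, h⟩ := reach_row hn i hi
    have hk : ∀ k : ℕ, k + 3 ≤ n →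
        Reach snakeAlgorithm m n cornerConfig (place (origin n s i k) s cornerConfig ∘ σ) :=
      fun k hk => h.trans <|
        (reach_along_row hs (Int.natCast_nonneg i) (by omega) k hk).comp_perm σ
    have hlast := hk (n - 3) (by omega)
    rw [Nat.cast_sub hn] at hlast
    exact ⟨s, hs, σ, hk,
      hlast.trans <| (reach_lowerAdvanced hs (Int.natCast_nonneg i) (by omega) (by push_cast; omega)
        (by push_cast; omega)).comp_perm σ,
      hlast.trans <| (reach_turning_zero hs (Int.natCast_nonneg i) (by omega) hn).comp_perm σ⟩
  have visit : ∀ {C : Config 4 Color} {σ : Equiv.Perm (Fin 4)} {o : ℤ × ℤ} {s : ℤ}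
      (r : Fin 4) {v : ℤ × ℤ}, Reach snakeAlgorithm m n cornerConfig (place o s C ∘ σ) →
      o + mirror s (C r).pos = v →
      ∃ C, Reach snakeAlgorithm m n cornerConfig C ∧ ∃ r, (C r).pos = v := by
    intro C σ o s r v h hv
    exact ⟨_, h, σ.symm r, by simpa [place] using hv⟩
  apply solvesAsyncFrom_of_reach
  · rintro ⟨x, y⟩ ⟨hx, hxm, hy, hyn⟩
    simp only at hx hxm hy hyn
    lift x to ℕ using hx
    by_cases hxl : x + 1 < m
    · obtain ⟨s, hs, σ, hk, -, -⟩ := along x hxl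
      obtain ⟨c, hc⟩ : ∃ c : ℕ, (c : ℤ) = if s = 1 then y else n - 1 - y :=
        Int.eq_ofNat_of_zero_le (by split_ifs <;> omega) |>.imp fun _ h => h.symm
      by_cases h1 : c + 3 ≤ n
      -- In all rows but the last, the rear robot G visits every column up to `n - 3`; the two
      -- robots ahead of it cover the final two.
      · refine visit 0 (hk c h1) ?_
        rcases hs with rfl | rfl <;> simp [origin, mirror, cornerConfig] at hc ⊢ <;> omega
      · by_cases h2 : c + 2 = n
        · refine visit 1 (hk (n - 3) (by omega)) ?_
          rcases hs with rfl | rfl <;> simp [origin, mirror, cornerConfig] at hc ⊢ <;> omega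
        · have h3 : c + 1 = n := by
            rcases hs with rfl | rfl <;> simp at hc <;> omega
          refine visit 2 (hk (n - 3) (by omega)) ?_
          rcases hs with rfl | rfl <;> simp [origin, mirror, cornerConfig] at hc ⊢ <;> omega
    -- The last row is the lower row of the final pass: robot `3` covers it up to column `n - 2`,
    -- and the front robot steps down into the corner.
    · obtain ⟨s, hs, σ, hk, hl, ht⟩ := along (m - 2) (by omega)
      obtain ⟨c, hc⟩ : ∃ c : ℕ, (c : ℤ) = if s = 1 then y else n - 1 - y :=
        Int.eq_ofNat_of_zero_le (by split_ifs <;> omega) |>.imp fun _ h => h.symm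
      by_cases h1 : c + 3 ≤ n
      · refine visit 3 (hk c h1) ?_
        rcases hs with rfl | rfl <;> simp [origin, mirror, cornerConfig] at hc ⊢ <;> omega
      · by_cases h2 : c + 2 = n
        · refine visit 3 hl ?_
          rcases hs with rfl | rfl <;> simp [origin, mirror, lowerAdvanced] at hc ⊢ <;> omega
        · have h3 : c + 1 = n := by
            rcases hs with rfl | rfl <;> simp at hc <;> omega
          refine visit 2 ht ?_
          rcases hs with rfl | rfl <;> simp [origin, mirror, turning] at hc ⊢ <;> omega
  · obtain ⟨s, hs, σ, -, -, ht⟩ := along (m - 2) (by omega)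
    refine ⟨_, ht, fun r => ?_⟩
    rw [northView_comp_perm]
    exact not_enabled_turning_zero hs (by omega) (by omega) hn _

end Run

end MyopicRobots

theorem mainTheorem9 :
    ∃ A : MyopicRobots.Algorithm 2 MyopicRobots.Color,
      ∀ m n : ℕ, 2 ≤ m → 3 ≤ n →
        MyopicRobots.SolvesAsyncFrom A m n MyopicRobots.cornerConfig :=
  ⟨MyopicRobots.snakeAlgorithm, fun _ _ => MyopicRobots.snakeAlgorithm_solves⟩
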